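/- **Theorem (Compactness and stability for BIP).** Let $\Gamma\in\mathbb{R}^{d\times d}$ be symmetric positive definite, $|y|_\Gamma:=\sqrt{\langle y,\Gamma^{-1}y\rangle}$, and let $\rho:\mathbb{R}^d\to(0,\infty)$ be a probability density with respect to Lebesgue measure (the noise density) which is Lipschitz continuous with respect to $|\cdot|_\Gamma$, bounded from above, and satisfies $\rho(y)\ge \frac1c\exp(-\frac12|y|_\Gamma^2)$ for all $y\in\mathbb{R}^d$, for some constant $c>0$. For a separable Banach space $X$, let $\mathcal{P}_1(X)$ be the set of Borel probability measures on $X$ with finite first moment, metrized by the $1$-Wasserstein distance $W_1(\mu,\nu)=\inf_\pi\int\Vert u-v\Vert_X\,\pi(du,dv)$, the infimum being over all couplings $\pi$ of $\mu$ and $\nu$, and let $C_{\mathrm{loc}}(\mathbb{R}^d;\mathcal{P}_1(X))$ be the space of continuous maps $\mathbb{R}^d\to\mathcal{P}_1(X)$ with the topology of locally uniform convergence. Let $\mu_{\mathrm{prior}}\in\mathcal{P}_1(X)$, and let $\mathcal{L}^\Delta:X\to\mathbb{R}^d$ be Borel measurable maps indexed by $\Delta\in D$, where $D\subset(0,\infty)$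 accumulates at $0$. Suppose that there is $M>0$ with $\sup_{\Delta\in D}\Vert\mathcal{L}^\Delta\Vert_{L^2(\mu_{\mathrm{prior}})}\le M$. Let $\mu^{\Delta,y}$ be the posterior of the Bayesian inverse problem $y=\mathcal{L}^\Delta(\bar u)+\eta$ with prior $\bar u\sim\mu_{\mathrm{prior}}$ and independent noise $\eta\sim\rho(y)\,dy$, i.e. $$\mu^{\Delta,y}(d\bar u)=\frac{1}{Z^\Delta(y)}\exp\left(-\Phi^{\Delta,y}(\bar u)\right)\mu_{\mathrm{prior}}(d\bar u),\qquad \Phi^{\Delta,y}(\bar u)=-\log\rho(y-\mathcal{L}^\Delta(\bar u)),\qquad Z^\Delta(y)=\int_X \exp\left(-\Phi^{\Delta,y}(\bar u)\right)\mu_{\mathrm{prior}}(d\bar u).$$ Then: 1. For any $R>0$ there is a constant $C>0$, depending only on $R$, $M$, the noise $(\rho,\Gamma)$ and the first moment $\int_X\Vert \bar u\Vert_X\,\mu_{\mathrm{prior}}(d\bar u)$ (in particular not on $\Delta$), such that $W_1(\mu^{\Delta,y},\mu^{\Delta,y'})\le C|y-y'|_\Gamma$ for all $\Delta\in D$ and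 all $|y|_\Gamma,|y'|_\Gamma\le R$. 2. The maps $y\mapsto\mu^{\Delta,y}$, $\Delta\in D$, belong to $C_{\mathrm{loc}}(\mathbb{R}^d;\mathcal{P}_1(X))$ and form a precompact (relatively compact) subset of it. 3. There are a sequence $\Delta_k\to0$ in $D$ and $\mu^{\ast,y}\in\mathcal{P}_1(X)$, $y\in\mathbb{R}^d$, such that $\sup_{|y|_\Gamma\le R}W_1(\mu^{\Delta_k,y},\mu^{\ast,y})\to0$ for every $R>0$. 4. For any sequence $\Delta_k\to0$ in $D$ and any limit $y\mapsto\mu^{\ast,y}\in\mathcal{P}_1(X)$ in the sense of 3, the map $y\mapsto\mu^{\ast,y}$ is locally Lipschitz: for any $R>0$ there is $K>0$ with $W_1(\mu^{\ast,y},\mu^{\ast,y'})\le K|y-y'|_\Gamma$ for all $|y|_\Gamma,|y'|_\Gamma\le R$. Moreover, for every $y$ there is a measurable function $\Phi^{\ast,y}:X\to\mathbb{R}$ such that $d\mu^{\ast,y}=\frac{1}{Z^\ast(y)}\exp(-\Phi^{\ast,y}(\bar u))\,d\mu_{\mathrm{prior}}$, where $Z^\ast(y)=\int_X\exp(-\Phi^{\ast,y})\,d\mu_{\mathrm{prior}}<\infty$.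 -/

import Mathlib

open MeasureTheory ProbabilityTheory Filter Topology
open scoped ENNReal

universe u

set_option linter.unusedSectionVars false

/-! ### The 1-Wasserstein space over a separable Banach space -/

/-- The couplings of two measures: probability measures on the product with the given marginals. -/
def couplings {X : Type*} [MeasurableSpace X] (μ ν : Measure X) : Set (Measure (X × X)) :=
  {π | IsProbabilityMeasure π ∧ π.map Prod.fst = μ ∧ π.map Prod.snd = ν}

/-- The 1-Wasserstein distance, as an infimum over couplings. -/
noncomputable def wasserstein {X : Type*} [NormedAddCommGroup X] [MeasurableSpace X]
    (μ ν : Measure X) : ℝ≥0∞ :=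
  ⨅ π ∈ couplings μ ν, ∫⁻ p, ‖p.1 - p.2‖ₑ ∂π

/-- Borel probability measures on `X` with finite first moment. -/
@[ext]
structure ProbOne (X : Type*) [NormedAddCommGroup X] [MeasurableSpace X] where
  toMeasure : Measure X
  isProb : IsProbabilityMeasure toMeasure
  moment_lt_top : ∫⁻ x, ‖x‖ₑ ∂toMeasure < ∞

namespace ProbOne

section Basic

variable {X : Type*} [NormedAddCommGroup X] [MeasurableSpace X]

instance (μ : ProbOne X) : IsProbabilityMeasure μ.toMeasure := μ.isProb

/-- The first moment of the measure, as a real number. -/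
noncomputable def moment (μ : ProbOne X) : ℝ := ∫ x, ‖x‖ ∂μ.toMeasure

end Basic

section Metric

variable {X : Type*} [NormedAddCommGroup X] [CompleteSpace X] [SecondCountableTopology X]
  [MeasurableSpace X] [BorelSpace X]

theorem wasserstein_self (μ : ProbOne X) : wasserstein μ.toMeasure μ.toMeasure = 0 := by
  have hm : Measurable fun x : X => (x, x) := by fun_prop
  have hc : μ.toMeasure.map (fun x => (x, x)) ∈ couplings μ.toMeasure μ.toMeasure := by
    refine ⟨Measure.isProbabilityMeasure_map hm.aemeasurable, ?_, ?_⟩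
    · rw [Measure.map_map measurable_fst hm]; exact Measure.map_id
    · rw [Measure.map_map measurable_snd hm]; exact Measure.map_id
  refine le_antisymm ((iInf₂_le _ hc).trans ?_) bot_le
  rw [lintegral_map (by fun_prop) hm]; simp

theorem wasserstein_comm_le (μ ν : Measure X) : wasserstein μ ν ≤ wasserstein ν μ := by
  refine le_iInf₂ fun π hπ => ?_
  obtain ⟨h0, h1, h2⟩ := hπ
  have hc : π.map Prod.swap ∈ couplings μ ν := by
    refine ⟨Measure.isProbabilityMeasure_map measurable_swap.aemeasurable, ?_, ?_⟩
    · rw [Measure.map_map measurable_fst measurable_swap]; exact h2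
    · rw [Measure.map_map measurable_snd measurable_swap]; exact h1
  refine (iInf₂_le _ hc).trans ?_
  rw [lintegral_map (by fun_prop) measurable_swap]
  refine lintegral_mono fun p => le_of_eq ?_
  simp only [Prod.fst_swap, Prod.snd_swap]
  rw [← edist_eq_enorm_sub, ← edist_eq_enorm_sub, edist_comm]

theorem wasserstein_triangle (μ ν κ : ProbOne X) :
    wasserstein μ.toMeasure κ.toMeasure ≤
      wasserstein μ.toMeasure ν.toMeasure + wasserstein ν.toMeasure κ.toMeasure := by
  refine (?_ : wasserstein μ.toMeasure κ.toMeasure ≤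
    wasserstein ν.toMeasure μ.toMeasure + wasserstein ν.toMeasure κ.toMeasure).trans
    (add_le_add_left (wasserstein_comm_le _ _) _)
  simp only [wasserstein, ENNReal.iInf_add, ENNReal.add_iInf]
  refine le_iInf₂ fun π hπ => le_iInf₂ fun σ hσ => ?_
  obtain ⟨hπ0, hπ1, hπ2⟩ := hπ
  obtain ⟨hσ0, hσ1, hσ2⟩ := hσ
  have eπ : ν.toMeasure ⊗ₘ π.condKernel = π := by
    rw [← hπ1]; exact π.disintegrate π.condKernel
  have eσ : ν.toMeasure ⊗ₘ σ.condKernel = σ := by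
    rw [← hσ1]; exact σ.disintegrate σ.condKernel
  set τ := ν.toMeasure ⊗ₘ (σ.condKernel ×ₖ π.condKernel) with hτ
  have tσ : τ.map (Prod.map id Prod.fst) = σ := by
    rw [hτ, ← Measure.compProd_map measurable_fst, ← Kernel.fst_eq, Kernel.fst_prod, eσ]
  have tπ : τ.map (Prod.map id Prod.snd) = π := by
    rw [hτ, ← Measure.compProd_map measurable_snd, ← Kernel.snd_eq, Kernel.snd_prod, eπ]
  have mσ : Measurable (Prod.map id Prod.fst : X × X × X → X × X) := by fun_prop
  have mπ : Measurable (Prod.map id Prod.snd : X × X × X → X × X) := by fun_prop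
  have hc : τ.map Prod.snd ∈ couplings μ.toMeasure κ.toMeasure := by
    refine ⟨Measure.isProbabilityMeasure_map measurable_snd.aemeasurable, ?_, ?_⟩
    · rw [← hσ2, ← tσ, Measure.map_map measurable_fst measurable_snd,
        Measure.map_map measurable_snd mσ]
      rfl
    · rw [← hπ2, ← tπ, Measure.map_map measurable_snd measurable_snd,
        Measure.map_map measurable_snd mπ]
      rfl
  refine (iInf₂_le _ hc).trans ?_
  rw [lintegral_map (by fun_prop) measurable_snd]
  conv_rhs => rw [← tσ, ← tπ]
  rw [lintegral_map (by fun_prop) mσ, lintegral_map (by fun_prop) mπ,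
    ← lintegral_add_left (by fun_prop)]
  refine lintegral_mono fun p => ?_
  simp only [Prod.map_fst, Prod.map_snd, id, ← edist_eq_enorm_sub]
  exact edist_triangle_left _ _ _

theorem wasserstein_ne_top (μ ν : ProbOne X) :
    wasserstein μ.toMeasure ν.toMeasure ≠ ∞ := by
  refine ne_top_of_le_ne_top ?_ (iInf₂_le (μ.toMeasure.prod ν.toMeasure)
    ⟨inferInstance, by simp, by simp⟩)
  have h : ∫⁻ p : X × X, ‖p.1 - p.2‖ₑ ∂(μ.toMeasure.prod ν.toMeasure) ≤
      ∫⁻ p : X × X, ‖p.1‖ₑ + ‖p.2‖ₑ ∂(μ.toMeasure.prod ν.toMeasure) :=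
    lintegral_mono fun p => enorm_sub_le
  refine ne_top_of_le_ne_top ?_ h
  rw [lintegral_add_left (by fun_prop)]
  have e1 := lintegral_map (μ := μ.toMeasure.prod ν.toMeasure) (f := fun x : X => ‖x‖ₑ)
    (by fun_prop) measurable_fst
  have e2 := lintegral_map (μ := μ.toMeasure.prod ν.toMeasure) (f := fun x : X => ‖x‖ₑ)
    (by fun_prop) measurable_snd
  rw [← e1, ← e2]
  simpa using ⟨μ.moment_lt_top.ne, ν.moment_lt_top.ne⟩

theorem measure_le_of_wasserstein_eq_zero {μ ν : ProbOne X}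
    (h : wasserstein μ.toMeasure ν.toMeasure = 0) {F : Set X} (hF : IsClosed F) :
    μ.toMeasure F ≤ ν.toMeasure F := by
  have key : ∀ δ : ℝ, 0 < δ → μ.toMeasure F ≤ ν.toMeasure (Metric.thickening δ F) := by
    intro δ hδ
    refine ENNReal.le_of_forall_pos_le_add fun ε hε _ => ?_
    have hpos : (0 : ℝ≥0∞) < ENNReal.ofReal δ * ε :=
      ENNReal.mul_pos (by simpa using hδ) (by simpa using hε.ne')
    rw [← h, wasserstein] at hpos
    obtain ⟨π, hπ⟩ := iInf_lt_iff.1 hpos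
    obtain ⟨⟨h0, h1, h2⟩, hc⟩ := iInf_lt_iff.1 hπ
    have hop : MeasurableSet (Metric.thickening δ F) := Metric.isOpen_thickening.measurableSet
    rw [← h1, ← h2, Measure.map_apply measurable_fst hF.measurableSet,
      Measure.map_apply measurable_snd hop]
    have hsub : Prod.fst ⁻¹' F ⊆ Prod.snd ⁻¹' (Metric.thickening δ F) ∪
        {p : X × X | ENNReal.ofReal δ ≤ ‖p.1 - p.2‖ₑ} := by
      intro p hp
      by_cases hd : ENNReal.ofReal δ ≤ ‖p.1 - p.2‖ₑ
      · exact Or.inr hd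
      · refine Or.inl (Metric.mem_thickening_iff.2 ⟨p.1, hp, ?_⟩)
        rw [not_le, ← edist_eq_enorm_sub, edist_dist, ENNReal.ofReal_lt_ofReal_iff hδ] at hd
        rwa [dist_comm]
    refine (measure_mono hsub).trans ((measure_union_le _ _).trans ?_)
    refine add_le_add_right ?_ _
    have hm := mul_meas_ge_le_lintegral₀ (μ := π) (f := fun p : X × X => ‖p.1 - p.2‖ₑ)
      (by fun_prop) (ENNReal.ofReal δ)
    exact (ENNReal.mul_le_mul_iff_right (by simpa using hδ) ENNReal.ofReal_ne_top).1
      (hm.trans hc.le)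
  have ht := tendsto_measure_thickening_of_isClosed (μ := ν.toMeasure) (s := F)
    ⟨1, one_pos, measure_ne_top _ _⟩ hF
  refine ge_of_tendsto ht ?_
  filter_upwards [self_mem_nhdsWithin] with δ hδ using key δ hδ

noncomputable instance : EMetricSpace (ProbOne X) where
  edist μ ν := wasserstein μ.toMeasure ν.toMeasure
  edist_self := wasserstein_self
  edist_comm μ ν := le_antisymm (wasserstein_comm_le _ _) (wasserstein_comm_le _ _)
  edist_triangle := wasserstein_triangle
  eq_of_edist_eq_zero := by
    intro μ ν h
    have h' : wasserstein ν.toMeasure μ.toMeasure = 0 :=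
      le_antisymm ((wasserstein_comm_le _ _).trans h.le) bot_le
    ext1
    refine ext_of_generate_finite _ (BorelSpace.measurable_eq.trans
      (borel_eq_generateFrom_isClosed (α := X))) isPiSystem_isClosed (fun F hF => ?_) (by simp)
    exact le_antisymm (measure_le_of_wasserstein_eq_zero h hF)
      (measure_le_of_wasserstein_eq_zero h' hF)

/-- The metric on measures with finite first moment is the 1-Wasserstein distance. -/
noncomputable instance : MetricSpace (ProbOne X) :=
  EMetricSpace.toMetricSpace wasserstein_ne_top

theorem edist_eq (μ ν : ProbOne X) : edist μ ν = wasserstein μ.toMeasure ν.toMeasure := rfl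

end Metric

end ProbOne

/-! ### Noise and Bayesian posterior -/

/-- The norm `|y|_Γ = √⟨y, Γ⁻¹ y⟩`. -/
noncomputable def normΓ {d : ℕ} (Γ : Matrix (Fin d) (Fin d) ℝ) (y : EuclideanSpace ℝ (Fin d)) : ℝ :=
  Real.sqrt (inner ℝ y (WithLp.toLp 2 (Matrix.mulVec Γ⁻¹ y.ofLp)))

/-- `ρ` is a positive probability density with respect to Lebesgue measure which is Lipschitz and
bounded and has at least Gaussian tails, relative to the norm `|y|_Γ`. -/
structure IsNoiseDensity {d : ℕ} (Γ : Matrix (Fin d) (Fin d) ℝ)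
    (ρ : EuclideanSpace ℝ (Fin d) → ℝ) : Prop where
  pos : ∀ y, 0 < ρ y
  lintegral_eq_one : ∫⁻ y, ENNReal.ofReal (ρ y) = 1
  lipschitz : ∃ K : ℝ, 0 < K ∧ ∀ y y', |ρ y - ρ y'| ≤ K * normΓ Γ (y - y')
  bounded : ∃ C : ℝ, 0 < C ∧ ∀ y, ρ y ≤ C
  tail : ∃ C : ℝ, 0 < C ∧ ∀ y, Real.exp (-(1 / 2) * normΓ Γ y ^ 2) / C ≤ ρ y

/-- The negative log-likelihood `Φ^y(u) = -log ρ(y - L(u))`. -/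
noncomputable def negLogLikelihood {X : Type*} {d : ℕ} (ρ : EuclideanSpace ℝ (Fin d) → ℝ)
    (L : X → EuclideanSpace ℝ (Fin d)) (y : EuclideanSpace ℝ (Fin d)) (u : X) : ℝ :=
  -Real.log (ρ (y - L u))

/-- The measure `exp(-Φ) μ / Z` with `Z = ∫ exp(-Φ) dμ`. -/
noncomputable def gibbs {X : Type*} [MeasurableSpace X] (μ : Measure X) (Φ : X → ℝ) : Measure X :=
  μ.tilted fun u => -Φ u

/-- The posterior of the Bayesian inverse problem `y = L(u) + η` with prior `μ` for `u` and
independent noise `η` of density `ρ`. -/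
noncomputable def bipPosterior {X : Type*} [MeasurableSpace X] {d : ℕ} (μ : Measure X)
    (ρ : EuclideanSpace ℝ (Fin d) → ℝ) (L : X → EuclideanSpace ℝ (Fin d))
    (y : EuclideanSpace ℝ (Fin d)) : Measure X :=
  gibbs μ (negLogLikelihood ρ L y)

/-! Write Z for the evidence. By Chebyshev, `‖L u‖ < 2M` outside prior mass 1/4, and there the
Gaussian tail bounds the likelihood below; hence Z is bounded below uniformly in Δ and locally in y
(`le_evidence`). As ρ is bounded and Lipschitz, posterior densities with respect to the prior are
bounded and Lipschitz in y, uniformly in Δ and locally in y. Leaving the common mass of two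
densities in place gives W₁ ≤ ∫ |f - g| ‖u‖ dμ, which proves stability
(`wasserstein_bipPosterior_le`).

For compactness, measures below a fixed multiple of the prior form a W₁-compact set
(`isCompact_setOf_le_smul`): along an ultrafilter they converge setwise, domination makes the limit
a measure, and one simple function discretises them all with small error. Stability gives
equicontinuity, and Arzelà–Ascoli applies.

For a limit, the Lipschitz and upper density bounds persist. Its density is also positive
prior-a.e.: `le_bipPosterior_apply` bounds posterior mass below by prior mass, up to a Chebyshev
error uniform in Δ. So the logarithm of the density defines Φ. -/

/-! ### Explicit couplings and upper bounds for W₁. -/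

section Transport

variable {X : Type*} [NormedAddCommGroup X] [CompleteSpace X] [SecondCountableTopology X]
  [MeasurableSpace X] [BorelSpace X]

/-- Transporting the non-common parts of two measures by the product coupling. -/
theorem wasserstein_le_of_eq_add {ν₁ ν₂ κ α β : Measure X} [IsProbabilityMeasure ν₁]
    [IsProbabilityMeasure ν₂] (h₁ : ν₁ = κ + α) (h₂ : ν₂ = κ + β) :
    wasserstein ν₁ ν₂ ≤ ∫⁻ u, ‖u‖ₑ ∂α + ∫⁻ u, ‖u‖ₑ ∂β := by
  have m₁ : κ Set.univ + α Set.univ = 1 := by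
    rw [← Measure.add_apply, ← h₁, measure_univ]
  have m₂ : κ Set.univ + β Set.univ = 1 := by
    rw [← Measure.add_apply, ← h₂, measure_univ]
  have hκ : κ Set.univ ≠ ∞ := ne_top_of_le_ne_top ENNReal.one_ne_top (m₁ ▸ le_self_add)
  have hα : α Set.univ ≠ ∞ := ne_top_of_le_ne_top ENNReal.one_ne_top (m₁ ▸ le_add_self)
  have hαβ : α Set.univ = β Set.univ :=
    (ENNReal.add_right_inj hκ).1 (m₁.trans m₂.symm)
  have : IsFiniteMeasure κ := ⟨hκ.lt_top⟩
  have : IsFiniteMeasure α := ⟨hα.lt_top⟩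
  have : IsFiniteMeasure β := ⟨hαβ ▸ hα.lt_top⟩
  have hd : Measurable fun x : X => (x, x) := by fun_prop
  have d₁ : (κ.map fun x => (x, x)).map Prod.fst = κ := by
    rw [Measure.map_map measurable_fst hd]; exact Measure.map_id
  have d₂ : (κ.map fun x => (x, x)).map Prod.snd = κ := by
    rw [Measure.map_map measurable_snd hd]; exact Measure.map_id
  -- The coupling of α and β is divided by their common mass, so zero mass is treated apart.
  by_cases h0 : α Set.univ = 0
  · have a0 : α = 0 := Measure.measure_univ_eq_zero.1 h0
    have b0 : β = 0 := Measure.measure_univ_eq_zero.1 (hαβ ▸ h0)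
    subst a0 b0
    rw [add_zero] at h₁ h₂
    have hπ : IsProbabilityMeasure (κ.map fun x => (x, x)) := by
      have : IsProbabilityMeasure κ := h₁ ▸ ‹IsProbabilityMeasure ν₁›
      exact Measure.isProbabilityMeasure_map hd.aemeasurable
    refine (iInf₂_le (κ.map fun x => (x, x)) ⟨hπ, d₁.trans h₁.symm, d₂.trans h₂.symm⟩).trans ?_
    rw [lintegral_map (by fun_prop) hd]; simp
  · have hinv : (α Set.univ)⁻¹ * α Set.univ = 1 := ENNReal.inv_mul_cancel h0 hα
    set π : Measure (X × X) := κ.map (fun x => (x, x)) + (α Set.univ)⁻¹ • α.prod β with hπ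
    have p₁ : π.map Prod.fst = ν₁ := by
      rw [hπ, Measure.map_add _ _ measurable_fst, d₁, Measure.map_smul, Measure.map_fst_prod,
        ← hαβ, smul_smul, hinv, one_smul, h₁]
    have p₂ : π.map Prod.snd = ν₂ := by
      rw [hπ, Measure.map_add _ _ measurable_snd, d₂, Measure.map_smul, Measure.map_snd_prod,
        smul_smul, hinv, one_smul, h₂]
    have hp : IsProbabilityMeasure π := by
      refine ⟨?_⟩
      have := congrArg (fun m => m Set.univ) p₁
      simpa [Measure.map_apply measurable_fst] using this
    refine (iInf₂_le π ⟨hp, p₁, p₂⟩).trans ?_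
    have le : ∫⁻ p : X × X, ‖p.1 - p.2‖ₑ ∂(α.prod β) ≤
        ∫⁻ p : X × X, ‖p.1‖ₑ + ‖p.2‖ₑ ∂(α.prod β) := lintegral_mono fun p => enorm_sub_le
    rw [lintegral_add_left (by fun_prop)] at le
    have e1 := lintegral_map (μ := α.prod β) (f := fun x : X => ‖x‖ₑ)
      (by fun_prop) measurable_fst
    have e2 := lintegral_map (μ := α.prod β) (f := fun x : X => ‖x‖ₑ)
      (by fun_prop) measurable_snd
    rw [← e1, ← e2, Measure.map_fst_prod, Measure.map_snd_prod, lintegral_smul_measure,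
      lintegral_smul_measure, ← hαβ, smul_eq_mul, smul_eq_mul, ← mul_add] at le
    rw [hπ, lintegral_add_measure, lintegral_map (by fun_prop) hd, lintegral_smul_measure]
    simp only [sub_self, enorm_zero, lintegral_zero, zero_add, smul_eq_mul]
    calc _ ≤ (α Set.univ)⁻¹ * _ := mul_le_mul_right le _
      _ = _ := by rw [← mul_assoc, hinv, one_mul]

/-- The common part has density `min f g`; of the two truncated differences one vanishes at each
point, so their sum is |f - g|. -/
theorem wasserstein_withDensity_le {μ : Measure X} {f g : X → ℝ≥0∞} (hf : Measurable f)
    (hg : Measurable g) [IsProbabilityMeasure (μ.withDensity f)]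
    [IsProbabilityMeasure (μ.withDensity g)] :
    wasserstein (μ.withDensity f) (μ.withDensity g) ≤
      ∫⁻ u, ((f u - g u) + (g u - f u)) * ‖u‖ₑ ∂μ := by
  have h₁ : μ.withDensity f = μ.withDensity (fun u => min (f u) (g u)) +
      μ.withDensity (fun u => f u - g u) := by
    rw [← withDensity_add_left (hf.min hg)]
    congr 1; ext u; simp [add_comm, tsub_add_min]
  have h₂ : μ.withDensity g = μ.withDensity (fun u => min (f u) (g u)) +
      μ.withDensity (fun u => g u - f u) := by
    rw [← withDensity_add_left (hf.min hg)]
    congr 1; ext u; simp [add_comm, min_comm (f u), tsub_add_min]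
  refine (wasserstein_le_of_eq_add h₁ h₂).trans (le_of_eq ?_)
  have hfg : Measurable fun u => f u - g u := hf.sub hg
  have hgf : Measurable fun u => g u - f u := hg.sub hf
  rw [lintegral_withDensity_eq_lintegral_mul _ hfg (by fun_prop),
    lintegral_withDensity_eq_lintegral_mul _ hgf (by fun_prop),
    ← lintegral_add_left (by fun_prop)]
  simp [add_mul]

theorem wasserstein_map_le (ν : Measure X) [IsProbabilityMeasure ν] {s : X → X}
    (hs : Measurable s) : wasserstein ν (ν.map s) ≤ ∫⁻ u, ‖u - s u‖ₑ ∂ν := by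
  have hm : Measurable fun x : X => (x, s x) := by fun_prop
  have hc : ν.map (fun x => (x, s x)) ∈ couplings ν (ν.map s) := by
    refine ⟨Measure.isProbabilityMeasure_map hm.aemeasurable, ?_, ?_⟩
    · rw [Measure.map_map measurable_fst hm]; exact Measure.map_id
    · rw [Measure.map_map measurable_snd hm]; rfl
  refine (iInf₂_le _ hc).trans ?_
  rw [lintegral_map (by fun_prop) hm]

theorem map_simpleFunc_eq_sum_dirac (ν : Measure X) (s : SimpleFunc X X) :
    ν.map s = ∑ x ∈ s.range, ν (s ⁻¹' {x}) • Measure.dirac x := by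
  ext t ht
  rw [Measure.map_apply s.measurable ht, ← lintegral_indicator_one (s.measurable ht)]
  have h := SimpleFunc.map_lintegral (μ := ν) (t.indicator 1 : X → ℝ≥0∞) s
  rw [← SimpleFunc.lintegral_eq_lintegral] at h
  refine Eq.trans ?_ (h.trans ?_)
  · rfl
  · simp [Measure.dirac_apply' _ ht, mul_comm]

/-- Both push-forwards have the same finitely many atoms, so only differences of weights move. This
turns setwise convergence into W₁ convergence. -/
theorem wasserstein_map_simpleFunc_le (ν ν' : Measure X) [IsProbabilityMeasure ν]
    [IsProbabilityMeasure ν'] (s : SimpleFunc X X) :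
    wasserstein (ν.map s) (ν'.map s) ≤ ∑ x ∈ s.range,
      ((ν (s ⁻¹' {x}) - ν' (s ⁻¹' {x})) * ‖x‖ₑ + (ν' (s ⁻¹' {x}) - ν (s ⁻¹' {x})) * ‖x‖ₑ) := by
  have := Measure.isProbabilityMeasure_map (μ := ν) s.measurable.aemeasurable
  have := Measure.isProbabilityMeasure_map (μ := ν') s.measurable.aemeasurable
  have h₁ : ν.map s = ∑ x ∈ s.range, min (ν (s ⁻¹' {x})) (ν' (s ⁻¹' {x})) • Measure.dirac x +
      ∑ x ∈ s.range, (ν (s ⁻¹' {x}) - ν' (s ⁻¹' {x})) • Measure.dirac x := by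
    rw [map_simpleFunc_eq_sum_dirac, ← Finset.sum_add_distrib]
    refine Finset.sum_congr rfl fun x _ => ?_
    rw [← add_smul, add_comm, tsub_add_min]
  have h₂ : ν'.map s = ∑ x ∈ s.range, min (ν (s ⁻¹' {x})) (ν' (s ⁻¹' {x})) • Measure.dirac x +
      ∑ x ∈ s.range, (ν' (s ⁻¹' {x}) - ν (s ⁻¹' {x})) • Measure.dirac x := by
    rw [map_simpleFunc_eq_sum_dirac, ← Finset.sum_add_distrib]
    refine Finset.sum_congr rfl fun x _ => ?_
    rw [← add_smul, add_comm, min_comm, tsub_add_min]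
  refine (wasserstein_le_of_eq_add h₁ h₂).trans (le_of_eq ?_)
  rw [lintegral_finsetSum_measure, lintegral_finsetSum_measure, ← Finset.sum_add_distrib]
  simp [lintegral_smul_measure]

end Transport

/-! ### W₁-compactness of measures with bounded density. -/

section Compactness

variable {X : Type*} [NormedAddCommGroup X] [CompleteSpace X] [SecondCountableTopology X]
  [MeasurableSpace X] [BorelSpace X]

/-- The setwise limit along an ultrafilter of measures dominated by a fixed finite measure is a
measure. -/
theorem exists_measure_tendsto_of_ultrafilter {Ω ι : Type*} [MeasurableSpace Ω] {μ : Measure Ω}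
    [IsFiniteMeasure μ] (U : Ultrafilter ι) {ν : ι → Measure Ω} (h : ∀ᶠ i in U, ν i ≤ μ) :
    ∃ ν' : Measure Ω, ν' ≤ μ ∧
      ∀ A, MeasurableSet A → Tendsto (fun i => ν i A) U (𝓝 (ν' A)) := by
  -- `ℝ≥0∞` is compact, so limits along an ultrafilter always exist.
  have hlim : ∀ A : Set Ω, ∃ a, Tendsto (fun i => ν i A) U (𝓝 a) := fun A =>
    ⟨_, (U.map fun i => ν i A).le_nhds_lim⟩
  choose m hm using hlim
  have hle : ∀ A, m A ≤ μ A := fun A =>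
    le_of_tendsto (hm A) (h.mono fun i hi => hi A)
  have hU : ∀ A : ℕ → Set Ω, (∀ i, MeasurableSet (A i)) → Pairwise (Function.onFun Disjoint A) →
      m (⋃ i, A i) = ∑' i, m (A i) := by
    intro A hA hd
    have hsum : ∀ n, Tendsto (fun i => ∑ j ∈ Finset.range n, ν i (A j)) U
        (𝓝 (∑ j ∈ Finset.range n, m (A j))) := fun n => tendsto_finsetSum _ fun j _ => hm (A j)
    refine le_antisymm ?_ ?_
    -- Domination by μ controls the tails uniformly in `i`, so no mass is lost in the limit.
    · have htail : Tendsto (fun n => (∑' j, m (A j)) + ∑' k, μ (A (k + n))) atTop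
          (𝓝 ((∑' j, m (A j)) + 0)) := by
        have hfin : ∑' j, μ (A j) ≠ ∞ := by
          rw [← measure_iUnion hd hA]; exact measure_ne_top μ _
        exact tendsto_const_nhds.add (ENNReal.tendsto_sum_nat_add (fun j => μ (A j)) hfin)
      rw [add_zero] at htail
      refine ge_of_tendsto' htail fun n => ?_
      have h1 : m (⋃ i, A i) ≤ ∑ j ∈ Finset.range n, m (A j) + ∑' k, μ (A (k + n)) := by
        refine le_of_tendsto_of_tendsto (hm _) ((hsum n).add tendsto_const_nhds) ?_
        filter_upwards [h] with i hi
        rw [measure_iUnion hd hA, ← ENNReal.summable.sum_add_tsum_nat_add' (k := n)]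
        exact add_le_add le_rfl (ENNReal.tsum_le_tsum fun k => hi _)
      exact h1.trans (add_le_add (ENNReal.sum_le_tsum _) le_rfl)
    · refine ENNReal.tsum_le_of_sum_range_le fun n => ?_
      refine le_of_tendsto_of_tendsto' (hsum n) (hm _) fun i => ?_
      rw [measure_iUnion hd hA]
      exact ENNReal.sum_le_tsum _
  refine ⟨Measure.ofMeasurable (fun A _ => m A) (by simpa using hle ∅) hU, ?_, ?_⟩
  · refine Measure.le_iff.2 fun A hA => ?_
    rw [Measure.ofMeasurable_apply A hA]; exact hle A
  · intro A hA
    rw [Measure.ofMeasurable_apply A hA]; exact hm A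

namespace ProbOne

/-- The push-forward of a measure under a simple function. -/
noncomputable def mapSimple (ν : ProbOne X) (s : SimpleFunc X X) : ProbOne X where
  toMeasure := ν.toMeasure.map s
  isProb := Measure.isProbabilityMeasure_map s.measurable.aemeasurable
  moment_lt_top := by
    rw [lintegral_map (by fun_prop) s.measurable]
    have h := SimpleFunc.map_lintegral (μ := ν.toMeasure) (fun x : X => ‖x‖ₑ) s
    rw [← SimpleFunc.lintegral_eq_lintegral] at h
    refine lt_of_eq_of_lt (Eq.trans (by rfl) h) (ENNReal.sum_lt_top.2 fun x _ => ?_)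
    exact ENNReal.mul_lt_top enorm_lt_top (measure_lt_top _ _)

/-- Replacing the identity by a simple function `s` costs at most c ∫ ‖x - s x‖ dμ for every measure
below c μ; this is small since μ has a first moment. After that only finitely many weights have to
converge. -/
theorem exists_tendsto_of_ultrafilter {ι : Type*} (μ : ProbOne X) {c : ℝ≥0∞} (hc : c ≠ ∞)
    (U : Ultrafilter ι) {ν : ι → ProbOne X}
    (h : ∀ᶠ i in U, (ν i).toMeasure ≤ c • μ.toMeasure) :
    ∃ ν' : ProbOne X, ν'.toMeasure ≤ c • μ.toMeasure ∧ Tendsto ν U (𝓝 ν') ∧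
      ∀ A, MeasurableSet A →
        Tendsto (fun i => (ν i).toMeasure A) U (𝓝 (ν'.toMeasure A)) := by
  have hfin : IsFiniteMeasure (c • μ.toMeasure) := ⟨by simpa using hc.lt_top⟩
  obtain ⟨ν₀, hle, hset⟩ := exists_measure_tendsto_of_ultrafilter U h
  have hprob : IsProbabilityMeasure ν₀ := by
    refine ⟨tendsto_nhds_unique (hset _ MeasurableSet.univ) ?_⟩
    simp
  have hmom : ∫⁻ x, ‖x‖ₑ ∂ν₀ < ∞ := by
    refine (lintegral_mono' hle le_rfl).trans_lt ?_
    rw [lintegral_smul_measure]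
    exact ENNReal.mul_lt_top hc.lt_top μ.moment_lt_top
  set ν' : ProbOne X := ⟨ν₀, hprob, hmom⟩
  refine ⟨ν', hle, ?_, hset⟩
  rw [tendsto_iff_edist_tendsto_0, ENNReal.tendsto_nhds_zero]
  intro ε hε
  have happ := SimpleFunc.tendsto_approxOn_L1_enorm (μ := μ.toMeasure) (f := fun x : X => x)
    measurable_id (s := Set.univ) (y₀ := 0) (Set.mem_univ _) (by simp)
    (by simpa [HasFiniteIntegral] using μ.moment_lt_top)
  have happ' := ENNReal.Tendsto.const_mul happ (Or.inr hc)
  rw [mul_zero] at happ'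
  have hε3 : 0 < ε / 3 := ENNReal.div_pos hε.ne' (by simp)
  obtain ⟨n, hn⟩ := ((ENNReal.tendsto_nhds_zero.1 happ') _ hε3).exists
  set s : SimpleFunc X X := SimpleFunc.approxOn (fun x : X => x) measurable_id Set.univ 0
    (Set.mem_univ _) n
  have hs : ∀ κ : ProbOne X, κ.toMeasure ≤ c • μ.toMeasure → edist κ (κ.mapSimple s) ≤ ε / 3 := by
    intro κ hκ
    refine (wasserstein_map_le κ.toMeasure s.measurable).trans (le_trans ?_ hn)
    refine (lintegral_mono' hκ le_rfl).trans (le_of_eq ?_)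
    rw [lintegral_smul_measure]
    simp only [← edist_eq_enorm_sub, smul_eq_mul, edist_comm]
  have hsum : Tendsto (fun i => ∑ x ∈ s.range,
      (((ν i).toMeasure (s ⁻¹' {x}) - ν₀ (s ⁻¹' {x})) * ‖x‖ₑ +
        (ν₀ (s ⁻¹' {x}) - (ν i).toMeasure (s ⁻¹' {x})) * ‖x‖ₑ)) U (𝓝 0) := by
    have : (0 : ℝ≥0∞) = ∑ x ∈ s.range, ((ν₀ (s ⁻¹' {x}) - ν₀ (s ⁻¹' {x})) * ‖x‖ₑ +
        (ν₀ (s ⁻¹' {x}) - ν₀ (s ⁻¹' {x})) * ‖x‖ₑ) := by simp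
    rw [this]
    refine tendsto_finsetSum _ fun x _ => ?_
    have hx := hset (s ⁻¹' {x}) (s.measurableSet_fiber x)
    have ht := measure_ne_top ν₀ (s ⁻¹' {x})
    exact (ENNReal.Tendsto.mul_const (ENNReal.Tendsto.sub hx tendsto_const_nhds (Or.inl ht))
      (Or.inr enorm_ne_top)).add (ENNReal.Tendsto.mul_const
        (ENNReal.Tendsto.sub tendsto_const_nhds hx (Or.inl ht)) (Or.inr enorm_ne_top))
  filter_upwards [h, (ENNReal.tendsto_nhds_zero.1 hsum) _ hε3] with i hi hi'
  calc edist (ν i) ν' ≤ edist (ν i) ((ν i).mapSimple s) +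
        edist ((ν i).mapSimple s) (ν'.mapSimple s) + edist (ν'.mapSimple s) ν' :=
        edist_triangle4 _ _ _ _
    _ ≤ ε / 3 + ε / 3 + ε / 3 := by
        gcongr
        · exact hs _ hi
        · exact (wasserstein_map_simpleFunc_le _ _ s).trans hi'
        · rw [edist_comm]; exact hs _ hle
    _ = ε := ENNReal.add_thirds ε

/-- Measures with density bounded by `c` with respect to `μ` form a compact subset of the
1-Wasserstein space. -/
theorem isCompact_setOf_le_smul (μ : ProbOne X) {c : ℝ≥0∞} (hc : c ≠ ∞) :
    IsCompact {ν : ProbOne X | ν.toMeasure ≤ c • μ.toMeasure} := by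
  refine isCompact_iff_ultrafilter_le_nhds'.2 fun U hU => ?_
  obtain ⟨ν', hle, ht, -⟩ := exists_tendsto_of_ultrafilter μ hc U (ν := id) hU
  exact ⟨ν', hle, ht⟩

/-- Wasserstein convergence of measures with uniformly bounded densities is setwise. -/
theorem tendsto_apply_of_tendsto_of_le_smul {μ : ProbOne X} {c : ℝ≥0∞} (hc : c ≠ ∞)
    {ι : Type*} {l : Filter ι} {ν : ι → ProbOne X} {ν' : ProbOne X}
    (h : ∀ᶠ i in l, (ν i).toMeasure ≤ c • μ.toMeasure) (ht : Tendsto ν l (𝓝 ν'))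
    {A : Set X} (hA : MeasurableSet A) :
    Tendsto (fun i => (ν i).toMeasure A) l (𝓝 (ν'.toMeasure A)) := by
  -- Along each ultrafilter the setwise limit is also the W₁ limit, hence is `ν'`.
  refine tendsto_iff_ultrafilter _ _ _ |>.2 fun U hU => ?_
  obtain ⟨κ, -, h1, h2⟩ := exists_tendsto_of_ultrafilter μ hc U (h.filter_mono hU)
  rw [tendsto_nhds_unique (ht.mono_left hU) h1]
  exact h2 A hA

end ProbOne

end Compactness

/-! ### The norm |·|_Γ and pointwise bounds on the noise density. -/

section NormGamma

variable {d : ℕ} {Γ : Matrix (Fin d) (Fin d) ℝ}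

open scoped MatrixOrder in
-- Factor Γ⁻¹ = BᵀB. The norm properties of |·|_Γ are then inherited from the Euclidean norm.
theorem exists_normΓ_eq_norm (hΓ : Γ.PosDef) :
    ∃ B : EuclideanSpace ℝ (Fin d) →ₗ[ℝ] EuclideanSpace ℝ (Fin d),
      Function.Injective B ∧ ∀ y, normΓ Γ y = ‖B y‖ := by
  obtain ⟨B, hB⟩ := CStarAlgebra.nonneg_iff_eq_star_mul_self.mp hΓ.inv.posSemidef.nonneg
  have hnorm : ∀ y, normΓ Γ y = ‖Matrix.toLpLin 2 2 B y‖ := by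
    intro y
    rw [normΓ, EuclideanSpace.norm_eq, hB]
    congr 1
    rw [PiLp.inner_apply]
    have : ∀ v : Fin d → ℝ, dotProduct v (Matrix.mulVec (star B * B) v) =
        dotProduct (B.mulVec v) (B.mulVec v) := by
      intro v
      rw [← Matrix.mulVec_mulVec, Matrix.dotProduct_mulVec, Matrix.star_eq_conjTranspose,
        Matrix.vecMul_conjTranspose]
      simp
    have h := this y.ofLp
    simp only [dotProduct] at h
    simp only [RCLike.inner_apply, conj_trivial, Real.norm_eq_abs, sq_abs, Matrix.toLpLin_apply]
    simp only [sq]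
    rw [← h]
    exact Finset.sum_congr rfl fun i _ => mul_comm _ _
  refine ⟨Matrix.toLpLin 2 2 B, ?_, hnorm⟩
  rw [← LinearMap.ker_eq_bot, LinearMap.ker_eq_bot']
  intro y hy
  by_contra hne
  have h0 : normΓ Γ y = 0 := by rw [hnorm, hy, norm_zero]
  have hpos := hΓ.inv.dotProduct_mulVec_pos (x := y.ofLp) (by simpa using hne)
  rw [normΓ, Real.sqrt_eq_zero', PiLp.inner_apply] at h0
  simp only [dotProduct, star_trivial] at hpos
  simp only [RCLike.inner_apply, conj_trivial] at h0
  simp only [mul_comm] at h0 hpos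
  exact absurd hpos (not_lt.2 h0)

theorem normΓ_nonneg (y : EuclideanSpace ℝ (Fin d)) : 0 ≤ normΓ Γ y := Real.sqrt_nonneg _

theorem normΓ_sub_le (hΓ : Γ.PosDef) (y z : EuclideanSpace ℝ (Fin d)) :
    normΓ Γ (y - z) ≤ normΓ Γ y + normΓ Γ z := by
  obtain ⟨B, -, hB⟩ := exists_normΓ_eq_norm hΓ
  simp only [hB, map_sub]
  exact norm_sub_le _ _

theorem exists_normΓ_le (hΓ : Γ.PosDef) : ∃ A : ℝ, 0 < A ∧ ∀ y, normΓ Γ y ≤ A * ‖y‖ := by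
  obtain ⟨B, -, hB⟩ := exists_normΓ_eq_norm hΓ
  obtain ⟨A, hA, h⟩ := (LinearMap.toContinuousLinearMap B).bound
  exact ⟨A, hA, fun y => by rw [hB]; exact h y⟩

theorem exists_norm_le_normΓ (hΓ : Γ.PosDef) :
    ∃ A : ℝ, 0 ≤ A ∧ ∀ y : EuclideanSpace ℝ (Fin d), ‖y‖ ≤ A * normΓ Γ y := by
  obtain ⟨B, hinj, hB⟩ := exists_normΓ_eq_norm hΓ
  obtain ⟨A, -, hA⟩ := LinearMap.exists_antilipschitzWith B (LinearMap.ker_eq_bot.2 hinj)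
  refine ⟨A, A.2, fun y => ?_⟩
  rw [hB]
  simpa using hA.le_mul_dist y 0

theorem IsNoiseDensity.continuous (hΓ : Γ.PosDef) {ρ : EuclideanSpace ℝ (Fin d) → ℝ}
    (hρ : IsNoiseDensity Γ ρ) : Continuous ρ := by
  obtain ⟨K, hK, hlip⟩ := hρ.lipschitz
  obtain ⟨A, hA, hle⟩ := exists_normΓ_le hΓ
  refine (LipschitzWith.of_dist_le_mul (K := (K * A).toNNReal) fun y z => ?_).continuous
  rw [Real.coe_toNNReal _ (by positivity), Real.dist_eq, dist_eq_norm, mul_assoc]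
  exact (hlip y z).trans (mul_le_mul_of_nonneg_left (hle _) hK.le)

/-- The argument stays in the Γ-ball of radius R + A T, where the Gaussian is bounded below. Taking
`q` as a function fixed by the noise keeps later constants independent of the prior space and of Δ.
-/
theorem IsNoiseDensity.exists_lower_bound (hΓ : Γ.PosDef) {ρ : EuclideanSpace ℝ (Fin d) → ℝ}
    (hρ : IsNoiseDensity Γ ρ) : ∃ q : ℝ → ℝ → ℝ, (∀ R T, 0 < q R T) ∧
      ∀ R T y z, normΓ Γ y ≤ R → ‖z‖ ≤ T → q R T ≤ ρ (y - z) := by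
  obtain ⟨C, hC, htail⟩ := hρ.tail
  obtain ⟨A, hA, hle⟩ := exists_normΓ_le hΓ
  refine ⟨fun R T => Real.exp (-(1 / 2) * (R + A * T) ^ 2) / C, fun R T => by positivity, ?_⟩
  intro R T y z hy hz
  refine le_trans ?_ (htail _)
  have h1 : normΓ Γ (y - z) ≤ R + A * T :=
    (normΓ_sub_le hΓ y z).trans
      (add_le_add hy ((hle z).trans (mul_le_mul_of_nonneg_left hz hA.le)))
  have h2 := pow_le_pow_left₀ (normΓ_nonneg (Γ := Γ) (y - z)) h1 2
  gcongr ?_ / _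
  exact Real.exp_le_exp.2 (by linarith)

end NormGamma

/-! ### Chebyshev and two-sided bounds on the posterior. -/

theorem measureReal_norm_ge_le_sq {Ω F : Type*} [MeasurableSpace Ω] [NormedAddCommGroup F]
    {μ : Measure Ω} [IsFiniteMeasure μ] {f : Ω → F} (hf : AEStronglyMeasurable f μ) {M T : ℝ}
    (hM : 0 ≤ M) (hT : 0 < T) (h : eLpNorm f 2 μ ≤ ENNReal.ofReal M) :
    μ.real {u | T ≤ ‖f u‖} ≤ (M / T) ^ 2 := by
  have hch := meas_ge_le_mul_pow_eLpNorm_enorm μ two_ne_zero ENNReal.ofNat_ne_top hf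
    (ε := ENNReal.ofReal T) (by simpa using hT) (by simp)
  have hset : {u | ENNReal.ofReal T ≤ ‖f u‖ₑ} = {u | T ≤ ‖f u‖} := by
    ext u
    simp [← ofReal_norm, ENNReal.ofReal_le_ofReal_iff]
  rw [hset] at hch
  refine ENNReal.toReal_le_of_le_ofReal (by positivity) (hch.trans ?_)
  simp only [ENNReal.toReal_ofNat, ENNReal.rpow_two]
  rw [← ENNReal.ofReal_inv_of_pos hT, ← ENNReal.ofReal_pow (by positivity), div_pow,
    div_eq_inv_mul, ENNReal.ofReal_mul (by positivity), inv_pow, ENNReal.ofReal_pow hM]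
  gcongr

section Posterior

variable {X : Type*} [MeasurableSpace X] {d : ℕ} {μ : Measure X} [IsProbabilityMeasure μ]
  {ρ : EuclideanSpace ℝ (Fin d) → ℝ} {L : X → EuclideanSpace ℝ (Fin d)}
  {y y' : EuclideanSpace ℝ (Fin d)} {B : ℝ}

theorem bipPosterior_eq_withDensity (hpos : ∀ y, 0 < ρ y) :
    bipPosterior μ ρ L y =
      μ.withDensity fun u => ENNReal.ofReal (ρ (y - L u) / ∫ v, ρ (y - L v) ∂μ) := by
  simp [bipPosterior, gibbs, negLogLikelihood, Measure.tilted, Real.exp_log (hpos _)]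

theorem integrable_likelihood (hc : Continuous ρ) (hpos : ∀ y, 0 < ρ y) (hB : ∀ y, ρ y ≤ B)
    (hL : Measurable L) : Integrable (fun u => ρ (y - L u)) μ :=
  Integrable.of_bound (hc.measurable.comp (hL.const_sub y)).aestronglyMeasurable B
    (ae_of_all _ fun u => by rw [Real.norm_of_nonneg (hpos _).le]; exact hB _)

theorem evidence_pos (hc : Continuous ρ) (hpos : ∀ y, 0 < ρ y) (hB : ∀ y, ρ y ≤ B)
    (hL : Measurable L) : 0 < ∫ u, ρ (y - L u) ∂μ := by
  rw [integral_pos_iff_support_of_nonneg (fun u => (hpos _).le)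
    (integrable_likelihood hc hpos hB hL)]
  have : (Function.support fun u => ρ (y - L u)) = Set.univ :=
    Set.eq_univ_of_forall fun u => (hpos _).ne'
  simp [this]

theorem isProbabilityMeasure_bipPosterior (hc : Continuous ρ) (hpos : ∀ y, 0 < ρ y)
    (hB : ∀ y, ρ y ≤ B) (hL : Measurable L) : IsProbabilityMeasure (bipPosterior μ ρ L y) := by
  refine isProbabilityMeasure_tilted ?_
  simpa [negLogLikelihood, Real.exp_log (hpos _)] using integrable_likelihood hc hpos hB hL

theorem evidence_le (hc : Continuous ρ) (hpos : ∀ y, 0 < ρ y) (hB : ∀ y, ρ y ≤ B)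
    (hL : Measurable L) : ∫ u, ρ (y - L u) ∂μ ≤ B := by
  refine (integral_mono (integrable_likelihood hc hpos hB hL) (integrable_const B)
    fun u => hB _).trans ?_
  simp

/-- At threshold 2M Chebyshev discards mass at most 1/4, leaving 3q/4 ≥ q/2. -/
theorem le_evidence (hc : Continuous ρ) (hpos : ∀ y, 0 < ρ y) (hB : ∀ y, ρ y ≤ B)
    (hL : Measurable L) {M q : ℝ} (hM : 0 < M) (hLM : eLpNorm L 2 μ ≤ ENNReal.ofReal M)
    (hq : 0 < q) (h : ∀ z, ‖z‖ ≤ 2 * M → q ≤ ρ (y - z)) : q / 2 ≤ ∫ u, ρ (y - L u) ∂μ := by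
  set S : Set X := {u | 2 * M ≤ ‖L u‖}
  have hS : MeasurableSet S := measurableSet_le measurable_const hL.norm
  have hSle : μ.real S ≤ 1 / 4 := by
    refine (measureReal_norm_ge_le_sq hL.aestronglyMeasurable hM.le (by positivity) hLM).trans
      (le_of_eq ?_)
    field_simp
    norm_num
  have hint : Integrable (S.indicator fun _ => q) μ := (integrable_const q).indicator hS
  have hle : ∫ u, (q - S.indicator (fun _ => q) u) ∂μ ≤ ∫ u, ρ (y - L u) ∂μ := by
    refine integral_mono ((integrable_const q).sub hint) (integrable_likelihood hc hpos hB hL)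
      fun u => ?_
    by_cases hu : u ∈ S
    · simpa [hu] using (hpos _).le
    · simpa [hu] using h (L u) (not_le.1 hu).le
  rw [integral_sub (integrable_const q) hint, integral_indicator_const _ hS] at hle
  simp only [integral_const, probReal_univ, smul_eq_mul] at hle
  nlinarith

theorem bipPosterior_le_smul (hpos : ∀ y, 0 < ρ y) (hB : ∀ y, ρ y ≤ B) {z : ℝ} (hz : 0 < z)
    (hZ : z ≤ ∫ u, ρ (y - L u) ∂μ) : bipPosterior μ ρ L y ≤ ENNReal.ofReal (B / z) • μ := by
  rw [bipPosterior_eq_withDensity hpos, ← withDensity_const]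
  refine withDensity_mono (ae_of_all _ fun u => ENNReal.ofReal_le_ofReal ?_)
  exact div_le_div₀ ((hpos 0).le.trans (hB 0)) (hB _) hz hZ

/-- Where `‖L u‖ < T` the density is at least q/B; the rest has prior mass at most (M/T)². The bound
involves L only through M, so it survives setwise limits. -/
theorem le_bipPosterior_apply (hc : Continuous ρ) (hpos : ∀ y, 0 < ρ y) (hB : ∀ y, ρ y ≤ B)
    (hL : Measurable L) {M T q : ℝ} (hM : 0 < M) (hT : 0 < T)
    (hLM : eLpNorm L 2 μ ≤ ENNReal.ofReal M) (h : ∀ z, ‖z‖ ≤ T → q ≤ ρ (y - z))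
    {A : Set X} (hA : MeasurableSet A) :
    ENNReal.ofReal (q / B) * (μ A - ENNReal.ofReal ((M / T) ^ 2)) ≤ bipPosterior μ ρ L y A := by
  set S : Set X := {u | T ≤ ‖L u‖}
  have hS : MeasurableSet S := measurableSet_le measurable_const hL.norm
  have hSle : μ S ≤ ENNReal.ofReal ((M / T) ^ 2) := by
    rw [← ofReal_measureReal (μ := μ)]
    exact ENNReal.ofReal_le_ofReal
      (measureReal_norm_ge_le_sq hL.aestronglyMeasurable hM.le hT hLM)
  have hsub : μ A - ENNReal.ofReal ((M / T) ^ 2) ≤ μ (A \ S) :=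
    (tsub_le_tsub_left hSle _).trans le_measure_sdiff
  calc _ ≤ ENNReal.ofReal (q / B) * μ (A \ S) := mul_le_mul_right hsub _
    _ = ∫⁻ _ in A \ S, ENNReal.ofReal (q / B) ∂μ := (setLIntegral_const _ _).symm
    _ ≤ ∫⁻ u in A \ S, ENNReal.ofReal (ρ (y - L u) / ∫ v, ρ (y - L v) ∂μ) ∂μ := by
        refine setLIntegral_mono' (hA.diff hS) fun u hu => ENNReal.ofReal_le_ofReal ?_
        exact div_le_div₀ (hpos _).le (h _ (not_le.1 hu.2).le) (evidence_pos hc hpos hB hL)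
          (evidence_le hc hpos hB hL)
    _ ≤ bipPosterior μ ρ L y (A \ S) := by
        rw [bipPosterior_eq_withDensity hpos]; exact withDensity_apply_le _ _
    _ ≤ bipPosterior μ ρ L y A := measure_mono Set.sdiff_subset

theorem abs_div_sub_div_le {a b Z W z B δ : ℝ} (hz : 0 < z) (hZ : z ≤ Z) (hW : z ≤ W)
    (hb : 0 ≤ b) (hbB : b ≤ B) (hab : |a - b| ≤ δ) (hZW : |Z - W| ≤ δ) :
    |a / Z - b / W| ≤ (1 / z + B / z ^ 2) * δ := by
  have hZ0 := hz.trans_le hZ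
  have hW0 := hz.trans_le hW
  have hδ : 0 ≤ δ := (abs_nonneg _).trans hab
  have e : a / Z - b / W = (a - b) / Z + b * (W - Z) / (Z * W) := by field_simp; ring
  rw [e, add_mul]
  refine (abs_add_le _ _).trans (add_le_add ?_ ?_)
  · rw [abs_div, abs_of_pos hZ0, one_div_mul_eq_div]
    exact div_le_div₀ hδ hab hz hZ
  · rw [abs_div, abs_mul, abs_of_nonneg hb, abs_of_pos (mul_pos hZ0 hW0), abs_sub_comm,
      div_mul_eq_mul_div]
    exact div_le_div₀ (mul_nonneg (hb.trans hbB) hδ) (mul_le_mul hbB hZW (abs_nonneg _)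
      (hb.trans hbB)) (by positivity) (by rw [sq]; exact mul_le_mul hZ hW hz.le hZ0.le)

end Posterior

/-! ### Lipschitz dependence of the posterior on the data. -/

section Stability

variable {X : Type*} [NormedAddCommGroup X] [CompleteSpace X] [SecondCountableTopology X]
  [MeasurableSpace X] [BorelSpace X] {d : ℕ} {ρ : EuclideanSpace ℝ (Fin d) → ℝ}
  {L : X → EuclideanSpace ℝ (Fin d)} {y y' : EuclideanSpace ℝ (Fin d)} {B : ℝ}

theorem ProbOne.ofReal_moment (μ : ProbOne X) :
    ENNReal.ofReal μ.moment = ∫⁻ u, ‖u‖ₑ ∂μ.toMeasure :=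
  ofReal_integral_norm_eq_lintegral_enorm (f := fun u : X => u)
    ⟨measurable_id.aestronglyMeasurable, μ.moment_lt_top⟩

/-- Averaging shows that the evidences also differ by at most δ. The normalised densities then
differ by a constant uniform in `u`, and integrating it against ‖u‖ produces the first moment. -/
theorem wasserstein_bipPosterior_le (μ : ProbOne X) (hc : Continuous ρ) (hpos : ∀ y, 0 < ρ y)
    (hB : ∀ y, ρ y ≤ B) (hL : Measurable L) {z δ : ℝ} (hz : 0 < z)
    (hZ : z ≤ ∫ u, ρ (y - L u) ∂μ.toMeasure) (hZ' : z ≤ ∫ u, ρ (y' - L u) ∂μ.toMeasure)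
    (hδ : ∀ u, |ρ (y - L u) - ρ (y' - L u)| ≤ δ) :
    wasserstein (bipPosterior μ.toMeasure ρ L y) (bipPosterior μ.toMeasure ρ L y') ≤
      ENNReal.ofReal ((1 / z + B / z ^ 2) * δ * μ.moment) := by
  have hp := isProbabilityMeasure_bipPosterior (μ := μ.toMeasure) (y := y) hc hpos hB hL
  have hp' := isProbabilityMeasure_bipPosterior (μ := μ.toMeasure) (y := y') hc hpos hB hL
  have hδ0 : 0 ≤ δ := (abs_nonneg _).trans (hδ 0)
  have hB0 : 0 ≤ B := (hpos 0).le.trans (hB 0)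
  have hi := integrable_likelihood (μ := μ.toMeasure) (y := y) hc hpos hB hL
  have hi' := integrable_likelihood (μ := μ.toMeasure) (y := y') hc hpos hB hL
  have hZZ : |(∫ u, ρ (y - L u) ∂μ.toMeasure) - ∫ u, ρ (y' - L u) ∂μ.toMeasure| ≤ δ := by
    rw [← integral_sub hi hi']
    have := norm_integral_le_of_norm_le_const (μ := μ.toMeasure)
      (f := fun u => ρ (y - L u) - ρ (y' - L u)) (C := δ) (ae_of_all _ hδ)
    simpa using this
  rw [bipPosterior_eq_withDensity hpos] at hp hp' ⊢
  rw [bipPosterior_eq_withDensity hpos]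
  have hm : ∀ v, Measurable fun u => ρ (v - L u) := fun v => hc.measurable.comp (hL.const_sub v)
  refine (wasserstein_withDensity_le ((hm y).div_const _).ennreal_ofReal
    ((hm y').div_const _).ennreal_ofReal).trans ?_
  rw [ENNReal.ofReal_mul (by positivity), μ.ofReal_moment, ← lintegral_const_mul _ (by fun_prop)]
  refine lintegral_mono fun u => mul_le_mul_left ?_ _
  have hb := abs_div_sub_div_le hz hZ hZ' (hpos (y' - L u)).le (hB _) (hδ u) hZZ
  have h1 : 0 ≤ ρ (y - L u) / ∫ v, ρ (y - L v) ∂μ.toMeasure :=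
    div_nonneg (hpos _).le (hz.le.trans hZ)
  have h2 : 0 ≤ ρ (y' - L u) / ∫ v, ρ (y' - L v) ∂μ.toMeasure :=
    div_nonneg (hpos _).le (hz.le.trans hZ')
  rw [← ENNReal.ofReal_sub _ h2, ← ENNReal.ofReal_sub _ h1]
  refine le_trans ?_ (ENNReal.ofReal_le_ofReal hb)
  rcases le_total (ρ (y - L u) / ∫ v, ρ (y - L v) ∂μ.toMeasure)
    (ρ (y' - L u) / ∫ v, ρ (y' - L v) ∂μ.toMeasure) with h | h
  · rw [ENNReal.ofReal_of_nonpos (sub_nonpos.2 h), zero_add, abs_sub_comm]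
    exact ENNReal.ofReal_le_ofReal (le_abs_self _)
  · rw [ENNReal.ofReal_of_nonpos (sub_nonpos.2 h), add_zero]
    exact ENNReal.ofReal_le_ofReal (le_abs_self _)

end Stability

/-! ### Gibbs form of equivalent measures, and Arzelà–Ascoli. -/

/-- Φ is minus the log-density. As μ ≪ ν the density is positive μ-a.e., so the convention log 0 = 0
matters only on a null set. -/
theorem exists_eq_gibbs {Ω : Type*} [MeasurableSpace Ω] {μ ν : Measure Ω} [IsProbabilityMeasure μ]
    [IsProbabilityMeasure ν] (hνμ : ν ≪ μ) (hμν : μ ≪ ν) :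
    ∃ Φ : Ω → ℝ, Measurable Φ ∧ Integrable (fun u => Real.exp (-Φ u)) μ ∧ ν = gibbs μ Φ := by
  have hexp : (fun u => Real.exp (- -llr ν μ u)) =ᵐ[μ] fun u => (ν.rnDeriv μ u).toReal := by
    simpa only [neg_neg] using exp_llr_of_ac' ν μ hμν
  refine ⟨fun u => -llr ν μ u, (measurable_llr ν μ).neg,
    (integrable_congr hexp).2 Measure.integrable_toReal_rnDeriv, ?_⟩
  have hint : ∫ u, Real.exp (- -llr ν μ u) ∂μ = 1 := by
    rw [integral_congr_ae hexp, Measure.integral_toReal_rnDeriv hνμ, probReal_univ]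
  rw [gibbs, Measure.tilted, hint]
  conv_lhs => rw [← Measure.withDensity_rnDeriv_eq ν μ hνμ]
  refine withDensity_congr_ae ?_
  filter_upwards [hexp, ν.rnDeriv_lt_top μ] with u hu hlt
  rw [hu, div_one, ENNReal.ofReal_toReal hlt.ne]

/-- Continuity on compact sets implies continuity in Y, so C(Y, α) is closed among all functions
under uniform convergence on compacts. -/
theorem ContinuousMap.isCompact_closure_of_equicontinuous {Y α : Type*} [TopologicalSpace Y]
    [CompactlyCoherentSpace Y] [UniformSpace α] [T2Space α] {s : Set C(Y, α)}
    (hs : Equicontinuous ((↑) : s → Y → α))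
    (hc : ∀ y, ∃ Q : Set α, IsCompact Q ∧ ∀ f ∈ s, f y ∈ Q) : IsCompact (closure s) := by
  refine ArzelaAscoli.isCompact_closure_of_isClosedEmbedding (𝔖 := {K : Set Y | IsCompact K})
    (F := fun f : C(Y, α) => (f : Y → α)) (fun K hK => hK) ?_ (fun K _ => hs.equicontinuousOn K)
    (fun K _ y _ => hc y)
  refine ⟨ContinuousMap.isUniformEmbedding_toUniformOnFunIsCompact.isEmbedding, ?_⟩
  change IsClosed (Set.range (ContinuousMap.toUniformOnFunIsCompact (α := Y) (β := α)))
  rw [ContinuousMap.range_toUniformOnFunIsCompact]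
  exact UniformOnFun.isClosed_setOfPred_continuous CompactlyCoherentSpace.isCoherentWith

/-! ### From local Γ-Lipschitz bounds to equicontinuity and locally uniform convergence. -/

section LocallyLipschitz

variable {d : ℕ} {Γ : Matrix (Fin d) (Fin d) ℝ}

theorem continuous_normΓ (hΓ : Γ.PosDef) : Continuous (normΓ Γ) := by
  obtain ⟨B, -, hB⟩ := exists_normΓ_eq_norm hΓ
  rw [show normΓ Γ = fun y => ‖B y‖ from funext hB]
  exact B.continuous_of_finiteDimensional.norm

theorem equicontinuous_of_normΓ_lipschitz (hΓ : Γ.PosDef) {ι α : Type*} [PseudoMetricSpace α]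
    {Q : ι → EuclideanSpace ℝ (Fin d) → α}
    (h : ∀ R > 0, ∃ C : ℝ, 0 < C ∧ ∀ i y y', normΓ Γ y ≤ R → normΓ Γ y' ≤ R →
      edist (Q i y) (Q i y') ≤ ENNReal.ofReal (C * normΓ Γ (y - y'))) : Equicontinuous Q := by
  intro y
  have hy := normΓ_nonneg (Γ := Γ) y
  -- The extra 1 puts a whole neighbourhood of `y` inside the Γ-ball.
  obtain ⟨C, hC, hle⟩ := h (normΓ Γ y + 1) (by positivity)
  refine Metric.equicontinuousAt_of_continuity_modulus (fun x => C * normΓ Γ (y - x)) ?_ _ ?_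
  · have hc : Continuous fun x => C * normΓ Γ (y - x) :=
      continuous_const.mul ((continuous_normΓ hΓ).comp (continuous_const.sub continuous_id))
    have := hc.tendsto y
    simpa [normΓ] using this
  · filter_upwards [(continuous_normΓ hΓ).continuousAt.eventually_le_const
      (lt_add_one (normΓ Γ y))] with x hx i
    have hnn : 0 ≤ C * normΓ Γ (y - x) := mul_nonneg hC.le (normΓ_nonneg _)
    have := hle i y x (by linarith) hx
    rwa [edist_dist, ENNReal.ofReal_le_ofReal_iff hnn] at this

theorem tendsto_iSup_edist_of_tendsto (hΓ : Γ.PosDef) {ι α : Type*} [PseudoMetricSpace α]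
    {l : Filter ι} {G : ι → C(EuclideanSpace ℝ (Fin d), α)} {g : C(EuclideanSpace ℝ (Fin d), α)}
    (h : Tendsto G l (𝓝 g)) (R : ℝ) :
    Tendsto (fun k => ⨆ (y : EuclideanSpace ℝ (Fin d)) (_ : normΓ Γ y ≤ R), edist (G k y) (g y))
      l (𝓝 0) := by
  obtain ⟨A, hA, hle⟩ := exists_norm_le_normΓ hΓ
  have hu := ContinuousMap.tendsto_iff_forall_isCompact_tendstoUniformlyOn.1 h _
    (isCompact_closedBall (0 : EuclideanSpace ℝ (Fin d)) (A * R))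
  rw [EMetric.tendstoUniformlyOn_iff] at hu
  refine ENNReal.tendsto_nhds_zero.2 fun ε hε => ?_
  filter_upwards [hu ε hε] with k hk
  refine iSup₂_le fun y hy => ?_
  rw [edist_comm]
  refine (hk y ?_).le
  rw [mem_closedBall_zero_iff]
  exact (hle y).trans (mul_le_mul_of_nonneg_left hy hA)

end LocallyLipschitz

/-! ### The main theorem. -/

theorem mainTheorem4 {d : ℕ} (Γ : Matrix (Fin d) (Fin d) ℝ) (hΓ : Γ.PosDef)
    (ρ : EuclideanSpace ℝ (Fin d) → ℝ) (hρ : IsNoiseDensity Γ ρ) :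
    -- `C R M m` depends only on the noise, on `R`, on `M` and on the first moment `m` of the prior
    ∃ C : ℝ → ℝ → ℝ → ℝ, (∀ R M m, 0 < C R M m) ∧
    ∀ (X : Type u) [NormedAddCommGroup X] [NormedSpace ℝ X] [CompleteSpace X]
      [SecondCountableTopology X] [MeasurableSpace X] [BorelSpace X]
      (prior : ProbOne X) (D : Set ℝ) (_ : D ⊆ Set.Ioi 0) (_ : (0 : ℝ) ∈ closure D)
      (L : ℝ → X → EuclideanSpace ℝ (Fin d)) (_ : ∀ Δ ∈ D, Measurable (L Δ))
      (M : ℝ) (_ : 0 < M)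
      (_ : ∀ Δ ∈ D, eLpNorm (L Δ) 2 prior.toMeasure ≤ ENNReal.ofReal M),
      -- local Lipschitz stability, uniformly in `Δ`
      (∀ R > 0, ∀ Δ ∈ D, ∀ y y' : EuclideanSpace ℝ (Fin d), normΓ Γ y ≤ R → normΓ Γ y' ≤ R →
        wasserstein (bipPosterior prior.toMeasure ρ (L Δ) y) (bipPosterior prior.toMeasure ρ (L Δ) y') ≤
          ENNReal.ofReal (C R M prior.moment * normΓ Γ (y - y'))) ∧
      -- relative compactness for the topology of locally uniform convergence
      (∃ F : D → C(EuclideanSpace ℝ (Fin d), ProbOne X),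
        (∀ Δ y, (F Δ y).toMeasure = bipPosterior prior.toMeasure ρ (L Δ) y) ∧
        IsCompact (closure (Set.range F))) ∧
      -- existence of a locally uniformly convergent subsequence
      (∃ δ : ℕ → ℝ, (∀ k, δ k ∈ D) ∧ Tendsto δ atTop (𝓝 0) ∧
        ∃ μlim : EuclideanSpace ℝ (Fin d) → ProbOne X,
          ∀ R > 0, Tendsto (fun k => ⨆ (y : EuclideanSpace ℝ (Fin d)) (_ : normΓ Γ y ≤ R),
            wasserstein (bipPosterior prior.toMeasure ρ (L (δ k)) y) (μlim y).toMeasure)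
            atTop (𝓝 0)) ∧
      -- properties of every such limit
      (∀ δ : ℕ → ℝ, (∀ k, δ k ∈ D) → Tendsto δ atTop (𝓝 0) →
        ∀ μlim : EuclideanSpace ℝ (Fin d) → ProbOne X,
          (∀ R > 0, Tendsto (fun k => ⨆ (y : EuclideanSpace ℝ (Fin d)) (_ : normΓ Γ y ≤ R),
            wasserstein (bipPosterior prior.toMeasure ρ (L (δ k)) y) (μlim y).toMeasure)
            atTop (𝓝 0)) →
          (∀ R > 0, ∃ K > 0, ∀ y y' : EuclideanSpace ℝ (Fin d), normΓ Γ y ≤ R → normΓ Γ y' ≤ R →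
            wasserstein (μlim y).toMeasure (μlim y').toMeasure ≤
              ENNReal.ofReal (K * normΓ Γ (y - y'))) ∧
          ∃ Φ : EuclideanSpace ℝ (Fin d) → X → ℝ, ∀ y,
            Measurable (Φ y) ∧ Integrable (fun u => Real.exp (-Φ y u)) prior.toMeasure ∧
              (μlim y).toMeasure = gibbs prior.toMeasure (Φ y)) := by
  have hc := hρ.continuous hΓ
  have hpos := hρ.pos
  obtain ⟨K, hK, hlip⟩ := hρ.lipschitz
  obtain ⟨B, hB, hbd⟩ := hρ.bounded
  obtain ⟨q, hq, hlow⟩ := hρ.exists_lower_bound hΓ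
  let z : ℝ → ℝ → ℝ := fun R M => q R (2 * M) / 2
  have hz : ∀ R M, 0 < z R M := fun R M => half_pos (hq _ _)
  let κ : ℝ → ℝ → ℝ := fun R M => (1 / z R M + B / z R M ^ 2) * K
  have hκ : ∀ R M, 0 < κ R M := fun R M => by have := hz R M; positivity
  -- `|m| + 1` dominates the moment and keeps the constant positive for every real `m`.
  have hC : ∀ R M m, 0 < κ R M * (|m| + 1) := fun R M m =>
    mul_pos (hκ R M) (by positivity)
  refine ⟨fun R M m => κ R M * (|m| + 1), hC, ?_⟩
  intro X _ _ _ _ _ _ prior D hD h0 L hL M hM hLM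
  have hZ : ∀ Δ ∈ D, ∀ R y, normΓ Γ y ≤ R → z R M ≤ ∫ u, ρ (y - L Δ u) ∂prior.toMeasure :=
    fun Δ hΔ R y hy => le_evidence hc hpos hbd (hL Δ hΔ) hM (hLM Δ hΔ) (hq _ _)
      fun v hv => hlow R (2 * M) y v hy hv
  have hstab : ∀ R, ∀ Δ ∈ D, ∀ y y' : EuclideanSpace ℝ (Fin d), normΓ Γ y ≤ R → normΓ Γ y' ≤ R →
      wasserstein (bipPosterior prior.toMeasure ρ (L Δ) y)
        (bipPosterior prior.toMeasure ρ (L Δ) y') ≤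
          ENNReal.ofReal (κ R M * (|prior.moment| + 1) * normΓ Γ (y - y')) := by
    intro R Δ hΔ y y' hy hy'
    refine (wasserstein_bipPosterior_le (δ := K * normΓ Γ (y - y')) prior hc hpos hbd (hL Δ hΔ)
      (hz R M) (hZ Δ hΔ R y hy) (hZ Δ hΔ R y' hy') fun u => ?_).trans
      (ENNReal.ofReal_le_ofReal ?_)
    · simpa using hlip (y - L Δ u) (y' - L Δ u)
    · calc _ = κ R M * normΓ Γ (y - y') * prior.moment := by simp only [κ]; ring
        _ ≤ κ R M * normΓ Γ (y - y') * (|prior.moment| + 1) :=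
          mul_le_mul_of_nonneg_left ((le_abs_self _).trans (le_add_of_nonneg_right zero_le_one))
            (mul_nonneg (hκ R M).le (normΓ_nonneg _))
        _ = _ := by ring
  let c : EuclideanSpace ℝ (Fin d) → ℝ≥0∞ := fun y => ENNReal.ofReal (B / z (normΓ Γ y) M)
  have hdom : ∀ Δ ∈ D, ∀ y, bipPosterior prior.toMeasure ρ (L Δ) y ≤ c y • prior.toMeasure :=
    fun Δ hΔ y => bipPosterior_le_smul hpos hbd (hz _ _) (hZ Δ hΔ _ y le_rfl)
  let P : D → EuclideanSpace ℝ (Fin d) → ProbOne X := fun Δ y =>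
    { toMeasure := bipPosterior prior.toMeasure ρ (L Δ) y
      isProb := isProbabilityMeasure_bipPosterior hc hpos hbd (hL Δ Δ.2)
      moment_lt_top := by
        refine (lintegral_mono' (hdom Δ Δ.2 y) le_rfl).trans_lt ?_
        rw [lintegral_smul_measure]
        exact ENNReal.mul_lt_top ENNReal.ofReal_lt_top prior.moment_lt_top }
  have hequi : Equicontinuous P := equicontinuous_of_normΓ_lipschitz hΓ fun R _ =>
    ⟨_, hC R M prior.moment, fun Δ y y' hy hy' => hstab R Δ Δ.2 y y' hy hy'⟩
  let F : D → C(EuclideanSpace ℝ (Fin d), ProbOne X) := fun Δ => ⟨P Δ, hequi.continuous Δ⟩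
  have hcomp : IsCompact (closure (Set.range F)) := by
    refine ContinuousMap.isCompact_closure_of_equicontinuous ?_ fun y =>
      ⟨_, ProbOne.isCompact_setOf_le_smul prior (c := c y) ENNReal.ofReal_ne_top, ?_⟩
    · intro y U hU
      filter_upwards [hequi y U hU] with x hx
      rintro ⟨_, Δ, rfl⟩
      exact hx Δ
    · rintro _ ⟨Δ, rfl⟩
      exact hdom Δ Δ.2 y
  refine ⟨fun R _ => hstab R, ⟨F, fun _ _ => rfl, hcomp⟩, ?_, ?_⟩
  · obtain ⟨δ, hδ, hδ0⟩ := mem_closure_iff_seq_limit.1 h0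
    -- A subsequence exists because locally uniform convergence on ℝᵈ is a first countable topology.
    obtain ⟨g, -, φ, hφ, hg⟩ := hcomp.tendsto_subseq (x := fun k => F ⟨δ k, hδ k⟩)
      fun k => subset_closure ⟨_, rfl⟩
    exact ⟨δ ∘ φ, fun k => hδ _, hδ0.comp hφ.tendsto_atTop, g, fun R _ =>
      tendsto_iSup_edist_of_tendsto hΓ hg R⟩
  · intro δ hδ _ μlim hlim
    have hpt : ∀ y, Tendsto (fun k => P ⟨δ k, hδ k⟩ y) atTop (𝓝 (μlim y)) := by
      intro y
      rw [tendsto_iff_edist_tendsto_0]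
      have hy := normΓ_nonneg (Γ := Γ) y
      -- The radius is raised by 1 because `hlim` covers only positive radii.
      refine tendsto_of_tendsto_of_tendsto_of_le_of_le tendsto_const_nhds
        (hlim (normΓ Γ y + 1) (by positivity)) (fun _ => zero_le) fun k => ?_
      exact le_iSup₂_of_le (f := fun (y : EuclideanSpace ℝ (Fin d)) (_ : normΓ Γ y ≤ _) =>
        wasserstein (bipPosterior prior.toMeasure ρ (L (δ k)) y) (μlim y).toMeasure)
        y (lt_add_one _).le le_rfl
    refine ⟨fun R _ => ⟨_, hC R M prior.moment, fun y y' hy hy' => ?_⟩, ?_⟩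
    · exact le_of_tendsto' ((hpt y).edist (hpt y')) fun k => hstab R _ (hδ k) y y' hy hy'
    · suffices h : ∀ y, ∃ Φ : X → ℝ, Measurable Φ ∧
          Integrable (fun u => Real.exp (-Φ u)) prior.toMeasure ∧
            (μlim y).toMeasure = gibbs prior.toMeasure Φ by
        choose Φ hΦ using h
        exact ⟨Φ, hΦ⟩
      intro y
      have hle : (μlim y).toMeasure ≤ c y • prior.toMeasure :=
        (ProbOne.isCompact_setOf_le_smul prior ENNReal.ofReal_ne_top).isClosed.mem_of_tendsto
          (hpt y) (Eventually.of_forall fun k => hdom _ (hδ k) y)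
      refine exists_eq_gibbs
        ((Measure.absolutelyContinuous_of_le hle).trans Measure.smul_absolutelyContinuous) ?_
      -- A null set of the limit is prior-null: the lower bound on posterior mass passes to the
      -- limit.
      refine Measure.AbsolutelyContinuous.mk fun A hA hA0 => ?_
      have hset := ProbOne.tendsto_apply_of_tendsto_of_le_smul (μ := prior) ENNReal.ofReal_ne_top
        (Eventually.of_forall fun k => hdom _ (hδ k) y) (hpt y) hA
      rw [hA0] at hset
      refine le_antisymm (ENNReal.le_of_forall_pos_le_add fun ε hε _ => ?_) zero_le
      have hε' : (0 : ℝ) < ε := hε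
      -- This choice makes the Chebyshev error (M/T)² equal to ε; as q/B > 0, the prior mass of A is
      -- at most ε.
      set T : ℝ := M / Real.sqrt ε
      have hT : (M / T) ^ 2 = ε := by
        rw [div_div_cancel₀ hM.ne', Real.sq_sqrt hε'.le]
      have hTpos : 0 < T := div_pos hM (Real.sqrt_pos.2 hε')
      have hge := ge_of_tendsto' hset fun k => le_bipPosterior_apply (y := y) hc hpos hbd
        (hL _ (hδ k)) hM hTpos (hLM _ (hδ k))
        (fun v hv => hlow (normΓ Γ y) T y v le_rfl hv) hA
      rw [hT, ENNReal.ofReal_coe_nnreal, nonpos_iff_eq_zero, mul_eq_zero] at hge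
      rcases hge with h | h
      · exact absurd h (by simpa using div_pos (hq _ _) hB)
      · rw [zero_add]
        exact tsub_eq_zero_iff_le.1 h
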